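/- A spacetime is a connected, Hausdorff, paracompact manifold $M$ of class $C^r$, $r\in\{3,4,\dots,\infty\}$, of dimension $n\ge 2$, with a Lorentzian metric $g$ of class $C^{r-1}$ and signature $(-,+,\dots,+)$ and a time orientation. For $p,q\in M$ write $p\ll q$ if there is a future directed (piecewise $C^1$) timelike curve from $p$ to $q$, and let $I^+(p)=\{q : p\ll q\}$ and $I^-(p)=\{q: q\ll p\}$. The spacetime is chronological if $p\ll p$ for no $p\in M$; it is future reflective if $p\in\overline{I^-(q)}$ implies $q\in\overline{I^+(p)}$ for all $p,q\in M$, and past reflective if $q\in\overline{I^+(p)}$ implies $p\in\overline{I^-(q)}$ for all $p,q\in M$. **Theorem.** Every chronological spacetime that is future reflective or past reflective admits a semi-time function, that is, a continuous function $t:M\to\mathbb{R}$ such that $p\ll q$ implies $t(p)<t(q)$ for all $p,q\in M$. -/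

import Mathlib

open scoped Manifold ContDiff

/-- A time-oriented Lorentzian metric on the `n`-dimensional (boundaryless) `C^r` manifold `M`.
The instance `IsManifold (𝓡 n) 1 M` is what gives the tangent bundle its topology; that `M` is a
connected Hausdorff paracompact manifold of class `C^r` is required where spacetimes are used. -/
structure Spacetime (n : ℕ) (r : ℕ∞) (M : Type*) [TopologicalSpace M]
    [ChartedSpace (EuclideanSpace ℝ (Fin n)) M] [IsManifold (𝓡 n) 1 M] where
  /-- The metric tensor. -/
  metric (x : M) : TangentSpace (𝓡 n) x →L[ℝ] TangentSpace (𝓡 n) x →L[ℝ] ℝ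
  symm (x : M) (v w : TangentSpace (𝓡 n) x) : metric x v w = metric x w v
  /-- The metric has signature `(-,+,…,+)`: every tangent space has an orthonormal basis whose
  first vector has square `-1` and whose other vectors have square `+1`. -/
  signature (x : M) : ∃ b : Module.Basis (Fin n) ℝ (TangentSpace (𝓡 n) x), ∀ i j : Fin n,
    metric x (b i) (b j) = if i = j then (if (i : ℕ) = 0 then -1 else 1) else 0
  /-- The metric tensor is of class `C^(r-1)`, the best class that makes sense on a `C^r`
  manifold (`∞ - 1 = ∞`). -/
  contMDiff_metric : ContMDiff (𝓡 n)
    ((𝓡 n).prod 𝓘(ℝ, EuclideanSpace ℝ (Fin n) →L[ℝ] EuclideanSpace ℝ (Fin n) →L[ℝ] ℝ))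
    (((r - 1 : ℕ∞)) : ℕ∞ω)
    (fun x ↦ Bundle.TotalSpace.mk'
      (EuclideanSpace ℝ (Fin n) →L[ℝ] EuclideanSpace ℝ (Fin n) →L[ℝ] ℝ)
      (E := fun y : M ↦ TangentSpace (𝓡 n) y →L[ℝ] TangentSpace (𝓡 n) y →L[ℝ] ℝ) x (metric x))
  /-- The time orientation, given by a continuous timelike vector field. -/
  timeField (x : M) : TangentSpace (𝓡 n) x
  timeField_timelike (x : M) : metric x (timeField x) (timeField x) < 0
  continuous_timeField : Continuous (fun x ↦ (⟨x, timeField x⟩ : TangentBundle (𝓡 n) M))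

namespace Spacetime

variable {n : ℕ} {r : ℕ∞} {M : Type*} [TopologicalSpace M]
  [ChartedSpace (EuclideanSpace ℝ (Fin n)) M] [IsManifold (𝓡 n) 1 M]

/-- A tangent vector is future directed timelike if it is timelike and lies in the same half of
the light cone as the vector field that gives the time orientation. -/
def IsFutureTimelike (S : Spacetime n r M) (x : M) (v : TangentSpace (𝓡 n) x) : Prop :=
  S.metric x v v < 0 ∧ S.metric x v (S.timeField x) < 0

/-- `γ : [a, b] → M` is of class `C^1` and its velocity is everywhere future directed timelike
(with one-sided derivatives at `a` and `b`). -/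
def IsC1TimelikeOn (S : Spacetime n r M) (γ : ℝ → M) (a b : ℝ) : Prop :=
  ContMDiffOn 𝓘(ℝ, ℝ) (𝓡 n) 1 γ (Set.Icc a b) ∧
  ∀ t ∈ Set.Icc a b,
    S.IsFutureTimelike (γ t) (mfderivWithin 𝓘(ℝ, ℝ) (𝓡 n) γ (Set.Icc a b) t (1 : ℝ))

/-- `γ : [a, b] → M` is a future directed timelike curve: there is a subdivision
`a = τ 0 < τ 1 < ⋯ < τ k = b`, `k ≥ 1`, such that `γ` is `C^1` with future directed timelike
velocity on every closed piece (so both one-sided velocities at a break point are future directed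
timelike, and `γ` is continuous). -/
def IsTimelikeCurve (S : Spacetime n r M) (γ : ℝ → M) (a b : ℝ) : Prop :=
  ∃ (k : ℕ) (τ : ℕ → ℝ), 0 < k ∧ τ 0 = a ∧ τ k = b ∧
    ∀ i < k, τ i < τ (i + 1) ∧ S.IsC1TimelikeOn γ (τ i) (τ (i + 1))

/-- The chronological relation `p ≪ q`: some future directed timelike curve goes from `p` to
`q`. -/
def Chron (S : Spacetime n r M) (p q : M) : Prop :=
  ∃ (γ : ℝ → M) (a b : ℝ), S.IsTimelikeCurve γ a b ∧ γ a = p ∧ γ b = q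

/-- The chronological future `I⁺(p)`. -/
def chronFuture (S : Spacetime n r M) (p : M) : Set M := {q | S.Chron p q}

/-- The chronological past `I⁻(p)`. -/
def chronPast (S : Spacetime n r M) (p : M) : Set M := {q | S.Chron q p}

/-- There is no closed timelike curve. -/
def IsChronological (S : Spacetime n r M) : Prop := ∀ p : M, ¬ S.Chron p p

def IsFutureReflective (S : Spacetime n r M) : Prop :=
  ∀ p q : M, p ∈ closure (S.chronPast q) → q ∈ closure (S.chronFuture p)

def IsPastReflective (S : Spacetime n r M) : Prop :=
  ∀ p q : M, q ∈ closure (S.chronFuture p) → p ∈ closure (S.chronPast q)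

/-- A semi-time function is a continuous function that strictly increases along `≪`. -/
def IsSemiTimeFunction (S : Spacetime n r M) (t : M → ℝ) : Prop :=
  Continuous t ∧ ∀ p q : M, S.Chron p q → t p < t q

end Spacetime

/-! In the past reflective case, take a timelike curve σ on [0, 1] and put f(x) = sup {s | σ(s) ≪
x}. This f is monotone along ≪. Openness of I⁺ makes f lower semicontinuous and past reflectivity
makes it upper semicontinuous (`continuous_sSup_param_of_reflective`).

Choose a countable dense D and one curve for each pair p ≪ q in D, and sum the resulting f with
summable positive weights. If x ≪ y, openness and density give p, q in D with x ≪ p ≪ q ≪ y. For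
that curve f(y) = 1, while f(x) = 0 by chronology, so the sum strictly increases. Reversing ≪
settles the future reflective case. The geometric input is that I⁺ and I⁻ are open, which rests on
`IsFutureTimelike.exists_chron_segments`. -/

open Set Filter Topology

/-! ### Representing a reflective order by a continuous function -/

section OrderedUtility

variable {X : Type*} [TopologicalSpace X]

/-- The function `x ↦ sup {s ∈ [0, 1] | σ s ≺ x}` is continuous if the curve `σ` is increasing, the
futures are open and `≺` is reflective. -/
theorem continuous_sSup_param_of_reflective {R : X → X → Prop}
    (htrans : ∀ {x y z}, R x y → R y z → R x z)
    (hfut : ∀ p, IsOpen {q | R p q})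
    (hrefl : ∀ p q, q ∈ closure {x | R p x} → p ∈ closure {x | R x q})
    {σ : ℝ → X} (hσ : ∀ s ∈ Icc (0 : ℝ) 1, ∀ t ∈ Icc (0 : ℝ) 1, s < t → R (σ s) (σ t)) :
    Continuous fun x ↦ sSup {s ∈ Icc (0 : ℝ) 1 | R (σ s) x} := by
  have hbdd : ∀ x, BddAbove {s ∈ Icc (0 : ℝ) 1 | R (σ s) x} := fun x ↦ ⟨1, fun s hs ↦ hs.1.2⟩
  refine continuous_iff_continuousAt.2 fun x ↦ tendsto_order.2 ⟨fun a ha ↦ ?_, fun a ha ↦ ?_⟩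
  -- The supremum of the empty set is 0 in ℝ, so the function is nonnegative everywhere, and a value
  -- above a ≥ 0 forces the set to be nonempty.
  · rcases lt_or_ge a 0 with h0 | h0
    · exact Eventually.of_forall fun y ↦ h0.trans_le (Real.sSup_nonneg fun s hs ↦ hs.1.1)
    have hne : {s ∈ Icc (0 : ℝ) 1 | R (σ s) x}.Nonempty := by
      by_contra h
      rw [not_nonempty_iff_eq_empty] at h
      simp only [h, Real.sSup_empty] at ha
      exact absurd ha h0.not_gt
    obtain ⟨s, hs, has⟩ := exists_lt_of_lt_csSup hne ha
    filter_upwards [(hfut (σ s)).mem_nhds hs.2] with y hy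
    exact has.trans_le (le_csSup (hbdd y) ⟨hs.1, hy⟩)
  · rcases lt_or_ge 1 a with h1 | h1
    · exact Eventually.of_forall fun y ↦
        (Real.sSup_le (fun s hs ↦ hs.1.2) zero_le_one).trans_lt h1
    have hx0 : 0 ≤ sSup {s ∈ Icc (0 : ℝ) 1 | R (σ s) x} := Real.sSup_nonneg fun s hs ↦ hs.1.1
    -- Two parameters are needed: reflectivity only puts σ s' in the closure of the past of x, and
    -- the open future of the earlier point σ s turns this into σ s ≺ x, although s exceeds the
    -- supremum.
    obtain ⟨s', hs', hs'a⟩ := exists_between ha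
    obtain ⟨s, hs, hss'⟩ := exists_between hs'
    have ms : s ∈ Icc (0 : ℝ) 1 := ⟨by linarith, by linarith⟩
    have ms' : s' ∈ Icc (0 : ℝ) 1 := ⟨by linarith, by linarith⟩
    have hx : x ∉ closure {y | R (σ s') y} := by
      intro hx
      obtain ⟨z, hz, hzx⟩ := mem_closure_iff.1 (hrefl _ _ hx) _ (hfut (σ s)) (hσ s ms s' ms' hss')
      exact absurd (le_csSup (hbdd x) ⟨ms, htrans hz hzx⟩) hs.not_ge
    filter_upwards [isClosed_closure.isOpen_compl.mem_nhds hx] with y hy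
    refine (Real.sSup_le (fun u hu ↦ ?_) ms'.1).trans_lt hs'a
    by_contra! hlt
    exact hy (subset_closure (htrans (hσ s' ms' u hu.1 hlt) hu.2))

/-- A transitive irreflexive relation with open futures and pasts, whose related points are
joined by increasing curves, is represented by a continuous function if it is reflective. -/
theorem exists_continuous_strictMono_of_reflective [TopologicalSpace.SeparableSpace X] {R : X → X → Prop}
    (htrans : ∀ {x y z}, R x y → R y z → R x z) (hirr : ∀ x, ¬ R x x)
    (hfut : ∀ p, IsOpen {q | R p q}) (hpast : ∀ q, IsOpen {p | R p q})
    (hcurve : ∀ p q, R p q → ∃ σ : ℝ → X, σ 0 = p ∧ σ 1 = q ∧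
      ∀ s ∈ Icc (0 : ℝ) 1, ∀ t ∈ Icc (0 : ℝ) 1, s < t → R (σ s) (σ t))
    (hrefl : ∀ p q, q ∈ closure {x | R p x} → p ∈ closure {x | R x q}) :
    ∃ t : X → ℝ, Continuous t ∧ ∀ p q, R p q → t p < t q := by
  obtain ⟨D, hDc, hD⟩ := TopologicalSpace.exists_countable_dense X
  have hbetween : ∀ x y, R x y → ∃ d ∈ D, R x d ∧ R d y := by
    intro x y hxy
    obtain ⟨σ, rfl, rfl, hσ⟩ := hcurve x y hxy
    have h0 : (0 : ℝ) ∈ Icc (0 : ℝ) 1 := by norm_num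
    have h1 : (1 : ℝ) ∈ Icc (0 : ℝ) 1 := by norm_num
    have hh : (1 / 2 : ℝ) ∈ Icc (0 : ℝ) 1 := by norm_num
    obtain ⟨d, ⟨hd1, hd2⟩, hdD⟩ := hD.inter_open_nonempty _ ((hfut (σ 0)).inter (hpast (σ 1)))
      ⟨σ (1 / 2), hσ 0 h0 _ hh (by norm_num), hσ _ hh 1 h1 (by norm_num)⟩
    exact ⟨d, hdD, hd1, hd2⟩
  let ι := {pq : D × D // R pq.1 pq.2}
  have : Countable D := hDc.to_subtype
  obtain ⟨e, he⟩ := exists_injective_nat ι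
  choose σ hσ0 hσ1 hσ using fun i : ι ↦ hcurve _ _ i.2
  let f : ι → X → ℝ := fun i x ↦ sSup {s ∈ Icc (0 : ℝ) 1 | R (σ i s) x}
  have hf : ∀ i, Continuous (f i) := fun i ↦
    continuous_sSup_param_of_reflective (R := R) (σ := σ i) htrans hfut hrefl (hσ i)
  have hbdd : ∀ i x, BddAbove {s ∈ Icc (0 : ℝ) 1 | R (σ i s) x} :=
    fun i x ↦ ⟨1, fun s hs ↦ hs.1.2⟩
  have hf0 : ∀ i x, 0 ≤ f i x := fun i x ↦ Real.sSup_nonneg fun s hs ↦ hs.1.1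
  have hf1 : ∀ i x, f i x ≤ 1 := fun i x ↦ Real.sSup_le (fun s hs ↦ hs.1.2) zero_le_one
  have hmono : ∀ i x y, R x y → f i x ≤ f i y := fun i x y hxy ↦
    Real.sSup_le (fun s hs ↦ le_csSup (hbdd i y) ⟨hs.1, htrans hs.2 hxy⟩) (hf0 i y)
  have hsum : Summable fun i : ι ↦ ((1 : ℝ) / 2) ^ e i := summable_geometric_two.comp_injective he
  have hle : ∀ i x, ((1 : ℝ) / 2) ^ e i * f i x ≤ (1 / 2) ^ e i := fun i x ↦
    mul_le_of_le_one_right (by positivity) (hf1 i x)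
  have hnn : ∀ i x, 0 ≤ ((1 : ℝ) / 2) ^ e i * f i x := fun i x ↦ mul_nonneg (by positivity) (hf0 i x)
  have hs : ∀ x, Summable fun i ↦ ((1 : ℝ) / 2) ^ e i * f i x := fun x ↦
    hsum.of_nonneg_of_le (fun i ↦ hnn i x) (fun i ↦ hle i x)
  refine ⟨fun x ↦ ∑' i, (1 / 2) ^ e i * f i x, ?_, fun x y hxy ↦ ?_⟩
  · refine continuous_tsum (fun i ↦ continuous_const.mul (hf i)) hsum fun i x ↦ ?_
    rw [Real.norm_of_nonneg (hnn i x)]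
    exact hle i x
  · obtain ⟨p, hpD, hxp, hpy⟩ := hbetween x y hxy
    obtain ⟨q, hqD, hpq, hqy⟩ := hbetween p y hpy
    let i : ι := ⟨(⟨p, hpD⟩, ⟨q, hqD⟩), hpq⟩
    refine (hs x).tsum_lt_tsum (i := i)
      (fun j ↦ mul_le_mul_of_nonneg_left (hmono j x y hxy) (by positivity)) ?_ (hs y)
    refine mul_lt_mul_of_pos_left ?_ (by positivity)
    have h0 : (0 : ℝ) ∈ Icc (0 : ℝ) 1 := by norm_num
    have h1 : (1 : ℝ) ∈ Icc (0 : ℝ) 1 := by norm_num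
    have hx : f i x ≤ 0 := by
      refine Real.sSup_le (fun s hs ↦ ?_) le_rfl
      -- Otherwise p ≺ σ s ≺ x ≺ p, a cycle.
      by_contra! hpos
      have h := hσ i 0 h0 s hs.1 hpos
      rw [hσ0 i] at h
      exact hirr p (htrans (htrans h hs.2) hxp)
    have hy : 1 ≤ f i y := le_csSup (hbdd i y) ⟨h1, by rw [hσ1 i]; exact hqy⟩
    linarith

end OrderedUtility

/-! ### From paracompactness to σ-compactness -/

/-- A connected, locally compact, paracompact Hausdorff space is σ-compact. -/
theorem sigmaCompactSpace_of_connected_paracompact (X : Type*) [TopologicalSpace X] [T2Space X]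
    [ParacompactSpace X] [ConnectedSpace X] [LocallyCompactSpace X] : SigmaCompactSpace X := by
  choose K hK hxK using fun x : X ↦ exists_compact_mem_nhds x
  obtain ⟨v, hvo, hvc, hvf, hvK⟩ := precise_refinement (fun x ↦ interior (K x))
    (fun x ↦ isOpen_interior) (iUnion_eq_univ_iff.2 fun x ↦ ⟨x, mem_interior_iff_mem_nhds.2 (hxK x)⟩)
  have hcpt : ∀ x, IsCompact (closure (v x)) := fun x ↦
    (hK x).closure_of_subset ((hvK x).trans interior_subset)
  have hfin : ∀ C : Set X, IsCompact C → {i | (v i ∩ C).Nonempty}.Finite := fun C hC ↦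
    hvf.finite_nonempty_inter_compact hC
  obtain ⟨x₀⟩ := (inferInstance : Nonempty X)
  -- Each stage takes the closures of the finitely many `v i` that meet the previous one. Any `v i`
  -- meeting the union therefore lies in it, which makes the union clopen.
  let F : ℕ → {C : Set X // IsCompact C} := fun n ↦ n.rec ⟨{x₀}, isCompact_singleton⟩ fun _ C ↦
    ⟨⋃ i ∈ {i | (v i ∩ C.1).Nonempty}, closure (v i),
      (hfin C.1 C.2).isCompact_biUnion fun i _ ↦ hcpt i⟩
  have hstep : ∀ n i, (v i ∩ (F n).1).Nonempty → v i ⊆ (F (n + 1)).1 := fun n i hi ↦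
    subset_closure.trans (subset_biUnion_of_mem (u := fun i ↦ closure (v i)) hi)
  have hex : ∀ x, ∃ i, x ∈ v i := iUnion_eq_univ_iff.1 hvc
  have hclopen : IsClopen (⋃ n, (F n).1) := by
    constructor
    · refine isClosed_of_closure_subset fun x hx ↦ ?_
      obtain ⟨i, hi⟩ := hex x
      obtain ⟨y, hyi, hy⟩ := mem_closure_iff.1 hx _ (hvo i) hi
      obtain ⟨n, hn⟩ := mem_iUnion.1 hy
      exact mem_iUnion.2 ⟨n + 1, hstep n i ⟨y, hyi, hn⟩ hi⟩
    · refine isOpen_iff_mem_nhds.2 fun x hx ↦ ?_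
      obtain ⟨n, hn⟩ := mem_iUnion.1 hx
      obtain ⟨i, hi⟩ := hex x
      exact mem_of_superset ((hvo i).mem_nhds hi)
        ((hstep n i ⟨x, hi, hn⟩).trans (subset_iUnion (fun n ↦ (F n).1) (n + 1)))
  have huniv : ⋃ n, (F n).1 = univ := hclopen.eq_univ ⟨x₀, mem_iUnion.2 ⟨0, mem_singleton x₀⟩⟩
  exact ⟨⟨fun n ↦ (F n).1, fun n ↦ (F n).2, huniv⟩⟩

/-! ### The open cone of future timelike vectors, and operations on timelike curves -/

namespace Spacetime

variable {n : ℕ} {r : ℕ∞} {M : Type*} [TopologicalSpace M]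
  [ChartedSpace (EuclideanSpace ℝ (Fin n)) M] [IsManifold (𝓡 n) 1 M]

theorem continuous_metric_apply (S : Spacetime n r M) {X : Type*} [TopologicalSpace X]
    {b : X → M} {v w : ∀ x, TangentSpace (𝓡 n) (b x)} (hb : Continuous b)
    (hv : Continuous fun x ↦ (⟨b x, v x⟩ : TangentBundle (𝓡 n) M))
    (hw : Continuous fun x ↦ (⟨b x, w x⟩ : TangentBundle (𝓡 n) M)) :
    Continuous fun x ↦ S.metric (b x) (v x) (w x) := by
  have h : Continuous fun x ↦ Bundle.TotalSpace.mk' ℝ (E := Bundle.Trivial M ℝ) (b x)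
      (S.metric (b x) (v x) (w x)) :=
    (S.contMDiff_metric.continuous.comp hb).clm_bundle_apply₂
      (F₁ := EuclideanSpace ℝ (Fin n)) (F₂ := EuclideanSpace ℝ (Fin n)) hv hw
  refine continuous_iff_continuousAt.2 fun x ↦ ?_
  have hx := h.continuousAt (x := x)
  simp only [FiberBundle.continuousAt_totalSpace] at hx
  exact hx.2

theorem isOpen_setOf_isFutureTimelike (S : Spacetime n r M) :
    IsOpen {v : TangentBundle (𝓡 n) M | S.IsFutureTimelike v.1 v.2} := by
  have hb : Continuous fun v : TangentBundle (𝓡 n) M ↦ v.1 :=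
    FiberBundle.continuous_proj (EuclideanSpace ℝ (Fin n)) (TangentSpace (𝓡 n) (M := M))
  have h1 : Continuous fun v : TangentBundle (𝓡 n) M ↦ S.metric v.1 v.2 v.2 :=
    S.continuous_metric_apply hb continuous_id continuous_id
  have h2 : Continuous fun v : TangentBundle (𝓡 n) M ↦ S.metric v.1 v.2 (S.timeField v.1) :=
    S.continuous_metric_apply hb continuous_id (S.continuous_timeField.comp hb)
  exact (isOpen_lt h1 continuous_const).inter (isOpen_lt h2 continuous_const)

theorem IsC1TimelikeOn.mono {S : Spacetime n r M} {γ : ℝ → M} {a b c d : ℝ}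
    (h : S.IsC1TimelikeOn γ a b) (hac : a ≤ c) (hcd : c < d) (hdb : d ≤ b) :
    S.IsC1TimelikeOn γ c d := by
  have hsub : Icc c d ⊆ Icc a b := Icc_subset_Icc hac hdb
  refine ⟨h.1.mono hsub, fun t ht ↦ ?_⟩
  rw [mfderivWithin_subset hsub (uniqueDiffOn_Icc hcd t ht).uniqueMDiffWithinAt
    ((h.1 t (hsub ht)).mdifferentiableWithinAt one_ne_zero)]
  exact h.2 t (hsub ht)

theorem IsC1TimelikeOn.congr {S : Spacetime n r M} {γ δ : ℝ → M} {a b : ℝ}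
    (h : S.IsC1TimelikeOn γ a b) (hγδ : ∀ t ∈ Icc a b, δ t = γ t) : S.IsC1TimelikeOn δ a b := by
  refine ⟨h.1.congr hγδ, fun t ht ↦ ?_⟩
  have h2 := h.2 t ht
  rw [mfderivWithin_congr_of_mem hγδ ht]
  unfold IsFutureTimelike at h2 ⊢
  rwa [hγδ t ht]

theorem IsC1TimelikeOn.comp_add_const {S : Spacetime n r M} {γ : ℝ → M} {a b : ℝ} (hab : a < b)
    (h : S.IsC1TimelikeOn γ a b) (c : ℝ) :
    S.IsC1TimelikeOn (fun t ↦ γ (t + c)) (a - c) (b - c) := by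
  have hmaps : MapsTo (fun t : ℝ ↦ t + c) (Icc (a - c) (b - c)) (Icc a b) := fun t ht ↦
    ⟨by linarith [ht.1], by linarith [ht.2]⟩
  have hc : ContMDiff 𝓘(ℝ, ℝ) 𝓘(ℝ, ℝ) 1 fun t : ℝ ↦ t + c :=
    (contDiff_id.add contDiff_const).contMDiff
  refine ⟨h.1.comp hc.contMDiffOn hmaps, fun t ht ↦ ?_⟩
  have hg : HasMFDerivWithinAt 𝓘(ℝ, ℝ) 𝓘(ℝ, ℝ) (fun t : ℝ ↦ t + c) (Icc (a - c) (b - c)) t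
      (ContinuousLinearMap.id ℝ ℝ) :=
    (((hasFDerivAt_id t).add_const c).hasFDerivWithinAt).hasMFDerivWithinAt
  have hγ := ((h.1 _ (hmaps ht)).mdifferentiableWithinAt one_ne_zero).hasMFDerivWithinAt
  have hu : UniqueMDiffWithinAt 𝓘(ℝ, ℝ) (Icc (a - c) (b - c)) t :=
    (uniqueDiffOn_Icc (by linarith) t ht).uniqueMDiffWithinAt
  have hd := (HasMFDerivWithinAt.comp t hγ hg hmaps.subset_preimage).mfderivWithin hu
  have h2 := h.2 _ (hmaps ht)
  change S.IsFutureTimelike (γ (t + c)) (mfderivWithin 𝓘(ℝ, ℝ) (𝓡 n) (γ ∘ fun t ↦ t + c) _ t (1 : ℝ))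
  rw [hd]
  exact h2

theorem IsC1TimelikeOn.chron {S : Spacetime n r M} {γ : ℝ → M} {a b : ℝ} (hab : a < b)
    (h : S.IsC1TimelikeOn γ a b) : S.Chron (γ a) (γ b) := by
  refine ⟨γ, a, b, ⟨1, fun i ↦ if i = 0 then a else b, one_pos, by simp, by simp, fun i hi ↦ ?_⟩,
    rfl, rfl⟩
  obtain rfl : i = 0 := by omega
  simpa using ⟨hab, h⟩

theorem Chron.trans {S : Spacetime n r M} {p q z : M} (hpq : S.Chron p q) (hqz : S.Chron q z) :
    S.Chron p z := by
  obtain ⟨γ, a, b, ⟨k, τ, hk, rfl, rfl, hτ⟩, rfl, rfl⟩ := hpq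
  obtain ⟨δ, c, d, ⟨l, ρ, hl, rfl, rfl, hρ⟩, hδ, rfl⟩ := hqz
  have hτmono : ∀ i ≤ k, τ i ≤ τ k := fun i hi ↦ by
    refine Nat.decreasingInduction' (P := fun j ↦ τ j ≤ τ k)
      (fun j hj _ ih ↦ ((hτ j hj).1.le).trans ih) hi le_rfl
  have hρmono : ∀ i ≤ l, ρ 0 ≤ ρ i := fun i hi ↦ by
    induction i with
    | zero => exact le_rfl
    | succ j ih => exact (ih (by omega)).trans (hρ j (by omega)).1.le
  let e := ρ 0 - τ k
  let η : ℝ → M := fun t ↦ if t ≤ τ k then γ t else δ (t + e)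
  let ν : ℕ → ℝ := fun i ↦ if i ≤ k then τ i else ρ (i - k) - e
  have hη1 : ∀ t ≤ τ k, η t = γ t := fun t ht ↦ if_pos ht
  -- Both formulas hold at the junction `τ k`, as is needed because the pieces are closed intervals.
  have hη2 : ∀ t, τ k ≤ t → η t = δ (t + e) := fun t ht ↦ by
    rcases ht.eq_or_lt with rfl | ht
    · rw [hη1 _ le_rfl, ← hδ]
      simp [e]
    · exact if_neg ht.not_ge
  have hν1 : ∀ i ≤ k, ν i = τ i := fun i hi ↦ if_pos hi
  have hν2 : ∀ i, ν (k + i) = ρ i - e := fun i ↦ by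
    rcases Nat.eq_zero_or_pos i with rfl | hi
    · rw [add_zero, hν1 k le_rfl]
      simp [e]
    · simp only [ν, if_neg (show ¬ k + i ≤ k by omega), Nat.add_sub_cancel_left]
  refine ⟨η, ν 0, ν (k + l), ⟨k + l, ν, by omega, rfl, rfl, fun i hi ↦ ?_⟩, ?_, ?_⟩
  · rcases lt_or_ge i k with hik | hik
    · rw [hν1 i hik.le, hν1 (i + 1) hik]
      exact ⟨(hτ i hik).1, (hτ i hik).2.congr fun t ht ↦ hη1 t (ht.2.trans (hτmono _ hik))⟩
    · obtain ⟨j, rfl⟩ := Nat.exists_eq_add_of_le hik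
      have hj := hρ j (by omega)
      rw [add_assoc, hν2, hν2]
      refine ⟨by linarith [hj.1], (hj.2.comp_add_const hj.1 e).congr fun t ht ↦ hη2 t ?_⟩
      have := hρmono j (by omega)
      have := ht.1
      simp only [e] at this
      linarith
  · rw [hν1 0 hk.le, hη1 _ (hτmono 0 hk.le)]
  · rw [hν2, hη2, sub_add_cancel]
    have := hρmono l le_rfl
    simp only [e]
    linarith

theorem chron_of_mem_Icc {S : Spacetime n r M} {γ : ℝ → M} {τ : ℕ → ℝ} (k : ℕ)
    (h : ∀ i < k, τ i < τ (i + 1) ∧ S.IsC1TimelikeOn γ (τ i) (τ (i + 1)))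
    {s t : ℝ} (hs : τ 0 ≤ s) (hst : s < t) (ht : t ≤ τ k) : S.Chron (γ s) (γ t) := by
  induction k generalizing s t with
  | zero => linarith
  | succ k ih =>
    have hk := h k (by omega)
    rcases le_or_gt t (τ k) with htk | htk
    · exact ih (fun i hi ↦ h i (by omega)) hs hst htk
    rcases le_or_gt (τ k) s with hsk | hsk
    · exact (hk.2.mono hsk hst ht).chron hst
    · exact (ih (fun i hi ↦ h i (by omega)) hs hsk le_rfl).trans ((hk.2.mono le_rfl htk ht).chron htk)

theorem Chron.exists_param {S : Spacetime n r M} {p q : M} (hpq : S.Chron p q) :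
    ∃ σ : ℝ → M, σ 0 = p ∧ σ 1 = q ∧
      ∀ s ∈ Icc (0 : ℝ) 1, ∀ t ∈ Icc (0 : ℝ) 1, s < t → S.Chron (σ s) (σ t) := by
  obtain ⟨γ, a, b, ⟨k, τ, hk, rfl, rfl, hτ⟩, rfl, rfl⟩ := hpq
  have hlt : τ 0 < τ k := by
    have : ∀ j < k, τ 0 < τ (j + 1) := fun j hj ↦ by
      induction j with
      | zero => exact (hτ 0 hj).1
      | succ j ih => exact (ih (by omega)).trans (hτ _ hj).1
    obtain ⟨j, rfl⟩ := Nat.exists_eq_succ_of_ne_zero hk.ne'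
    exact this j (by omega)
  -- Only the order of the points along the curve is used, so the rescaled curve need not be shown
  -- timelike.
  refine ⟨fun s ↦ γ (τ 0 + s * (τ k - τ 0)), by simp, by simp, fun s hs t ht hst ↦
    chron_of_mem_Icc k hτ ?_ ?_ ?_⟩
  · nlinarith [hs.1]
  · nlinarith
  · nlinarith [ht.2]

/-! ### Openness of chronological futures and pasts -/

/-- Near the point of a future directed timelike vector, chart segments whose chart velocity is
close to that of the vector are timelike. -/
theorem IsFutureTimelike.exists_chron_segments {S : Spacetime n r M} {q : M}
    {v : TangentSpace (𝓡 n) q} (hv : S.IsFutureTimelike q v) :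
    ∃ U ∈ 𝓝 (chartAt (EuclideanSpace ℝ (Fin n)) q q),
      ∃ W : Set (EuclideanSpace ℝ (Fin n)), IsOpen W ∧
        (mfderiv (𝓡 n) (𝓡 n) (chartAt (EuclideanSpace ℝ (Fin n)) q) q v :
          EuclideanSpace ℝ (Fin n)) ∈ W ∧
        ∀ y ∈ U, ∀ z ∈ U, ∀ h : ℝ, 0 < h → h⁻¹ • (z - y) ∈ W →
          S.Chron ((chartAt (EuclideanSpace ℝ (Fin n)) q).symm y)
            ((chartAt (EuclideanSpace ℝ (Fin n)) q).symm z) := by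
  let E := EuclideanSpace ℝ (Fin n)
  let φ := chartAt E q
  have hφ : φ.MDifferentiable (𝓡 n) (𝓡 n) := mdifferentiable_chart q
  have hq : q ∈ φ.source := mem_chart_source E q
  let w₀ : E := mfderiv (𝓡 n) (𝓡 n) φ q v
  have hψ : ContMDiffOn (𝓡 n) (𝓡 n) 1 φ.symm φ.target := contMDiffOn_chart_symm
  -- The preimage of the open future cone under this continuous map is open, so it contains a
  -- product neighbourhood of `(φ q, w₀)`. Shrinking the first factor to a ball keeps segments
  -- inside it by convexity.
  let Θ : E × E → TangentBundle (𝓡 n) M := fun yw ↦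
    ⟨φ.symm yw.1, mfderiv (𝓡 n) (𝓡 n) φ.symm yw.1 yw.2⟩
  have hΘ : ContinuousOn Θ (φ.target ×ˢ univ) := by
    have h1 := hψ.continuousOn_tangentMapWithin le_rfl φ.open_target.uniqueMDiffOn
    have h2 := h1.comp (s := φ.target ×ˢ univ)
      (tangentBundleModelSpaceHomeomorph (𝓡 n)).symm.continuous.continuousOn
      (fun yw hyw ↦ hyw.1)
    refine h2.congr fun yw hyw ↦ ?_
    change _ = (⟨φ.symm yw.1, mfderivWithin (𝓡 n) (𝓡 n) φ.symm φ.target yw.1 yw.2⟩ :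
      TangentBundle (𝓡 n) M)
    rw [mfderivWithin_of_isOpen φ.open_target hyw.1]
  have hopen : IsOpen ((φ.target ×ˢ univ) ∩ Θ ⁻¹' {v | S.IsFutureTimelike v.1 v.2}) :=
    hΘ.isOpen_inter_preimage (φ.open_target.prod isOpen_univ) S.isOpen_setOf_isFutureTimelike
  have hmem : (φ q, w₀) ∈ (φ.target ×ˢ univ) ∩ Θ ⁻¹' {v | S.IsFutureTimelike v.1 v.2} := by
    refine ⟨⟨φ.map_source hq, mem_univ _⟩, ?_⟩
    have h1 := hφ.symm_comp_deriv hq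
    have h2 : mfderiv (𝓡 n) (𝓡 n) φ.symm (φ q) w₀ = v := DFunLike.congr_fun h1 v
    change S.IsFutureTimelike (φ.symm (φ q)) (mfderiv (𝓡 n) (𝓡 n) φ.symm (φ q) w₀)
    rw [h2]
    unfold IsFutureTimelike at hv ⊢
    rwa [φ.left_inv hq]
  obtain ⟨U, W, hU, hUq, hW, hWw, hUW⟩ := mem_nhds_prod_iff'.1 (hopen.mem_nhds hmem)
  obtain ⟨ε, hε, hεU⟩ := Metric.isOpen_iff.1 hU _ hUq
  refine ⟨Metric.ball (φ q) ε, Metric.ball_mem_nhds _ hε, W, hW, hWw, fun y hy z hz h hh hw ↦ ?_⟩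
  set w : E := h⁻¹ • (z - y) with hw_def
  have hzw : y + h • w = z := by
    rw [hw_def, smul_smul, mul_inv_cancel₀ hh.ne', one_smul, add_sub_cancel]
  have hseg : ∀ s ∈ Icc (0 : ℝ) h, y + s • w ∈ Metric.ball (φ q) ε := fun s hs ↦ by
    have := (convex_ball (φ q) ε).add_smul_sub_mem hy hz
      (t := s * h⁻¹) ⟨by have := hs.1; positivity, by
        rw [← div_eq_mul_inv]; exact (div_le_one hh).2 hs.2⟩
    rwa [mul_smul] at this
  have hin : ∀ s ∈ Icc (0 : ℝ) h,
      (y + s • w, w) ∈ (φ.target ×ˢ univ) ∩ Θ ⁻¹' {v | S.IsFutureTimelike v.1 v.2} :=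
    fun s hs ↦ hUW ⟨hεU (hseg s hs), hw⟩
  have hc : ContMDiff 𝓘(ℝ, ℝ) (𝓡 n) 1 fun s : ℝ ↦ y + s • w :=
    (contDiff_const.add (contDiff_id.smul contDiff_const)).contMDiff
  have hC : S.IsC1TimelikeOn (φ.symm ∘ fun s : ℝ ↦ y + s • w) 0 h := by
    refine ⟨hψ.comp hc.contMDiffOn fun s hs ↦ (hin s hs).1.1, fun s hs ↦ ?_⟩
    have hd : HasDerivAt (fun s : ℝ ↦ y + s • w) w s := by
      simpa using ((hasDerivAt_id s).smul_const w).const_add y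
    have hd' : HasMFDerivWithinAt 𝓘(ℝ, ℝ) (𝓡 n) (fun s : ℝ ↦ y + s • w) (Icc 0 h) s
        (ContinuousLinearMap.toSpanSingleton ℝ w) :=
      hd.hasFDerivAt.hasFDerivWithinAt.hasMFDerivWithinAt
    have hm := (hφ.mdifferentiableAt_symm (hin s hs).1.1).hasMFDerivAt
    have hu : UniqueMDiffWithinAt 𝓘(ℝ, ℝ) (Icc 0 h) s :=
      (uniqueDiffOn_Icc hh s hs).uniqueMDiffWithinAt
    rw [(hm.comp_hasMFDerivWithinAt s hd').mfderivWithin hu]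
    have h3 := (hin s hs).2
    change S.IsFutureTimelike (φ.symm (y + s • w))
      (mfderiv (𝓡 n) (𝓡 n) φ.symm (y + s • w) ((1 : ℝ) • w))
    rw [one_smul]
    exact h3
  have := hC.chron hh
  simpa [hzw] using this

/-- The difference quotients in the chart tend to the velocity at `t₀`, hence enter the open set
`W`. For fixed `t` they stay in `W` when `γ t₀` is replaced by a nearby `y`, and the chart segment
between `γ t` and `y` is timelike. -/
theorem IsC1TimelikeOn.eventually_chron {S : Spacetime n r M} {γ : ℝ → M} {a b t₀ : ℝ}
    (h : S.IsC1TimelikeOn γ a b) (ht₀ : t₀ ∈ Icc a b) :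
    ∀ᶠ t in 𝓝[Icc a b \ {t₀}] t₀,
      (t < t₀ → ∀ᶠ y in 𝓝 (γ t₀), S.Chron (γ t) y) ∧
      (t₀ < t → ∀ᶠ y in 𝓝 (γ t₀), S.Chron y (γ t)) := by
  let E := EuclideanSpace ℝ (Fin n)
  let φ := chartAt E (γ t₀)
  have hq : γ t₀ ∈ φ.source := mem_chart_source E _
  obtain ⟨U, hU, W, hW, hWv, hUW⟩ := (h.2 t₀ ht₀).exists_chron_segments
  have hφ : φ.MDifferentiable (𝓡 n) (𝓡 n) := mdifferentiable_chart (γ t₀)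
  have hγ := (h.1 t₀ ht₀).mdifferentiableWithinAt one_ne_zero
  have hd : HasDerivWithinAt (φ ∘ γ) (mfderiv (𝓡 n) (𝓡 n) φ (γ t₀)
      (mfderivWithin 𝓘(ℝ, ℝ) (𝓡 n) γ (Icc a b) t₀ (1 : ℝ)) : E) (Icc a b) t₀ := by
    let L : ℝ →L[ℝ] E := (mfderiv (𝓡 n) (𝓡 n) φ (γ t₀)).comp
      (mfderivWithin 𝓘(ℝ, ℝ) (𝓡 n) γ (Icc a b) t₀)
    have hL : HasFDerivWithinAt (φ ∘ γ) L (Icc a b) t₀ :=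
      ((hφ.mdifferentiableAt hq).hasMFDerivAt.comp_hasMFDerivWithinAt t₀
        hγ.hasMFDerivWithinAt).hasFDerivWithinAt
    exact hL.hasDerivWithinAt
  have hslope := (hasDerivWithinAt_iff_tendsto_slope.1 hd).eventually (hW.mem_nhds hWv)
  have hφc : ContinuousAt φ (γ t₀) := φ.continuousAt hq
  have hγc : Tendsto γ (𝓝[Icc a b \ {t₀}] t₀) (𝓝 (γ t₀)) :=
    hγ.continuousWithinAt.mono sdiff_subset
  have hsrc := φ.open_source.mem_nhds hq
  filter_upwards [hslope, hγc.eventually hsrc, hγc.eventually (hφc.eventually hU)] with t hW' hts htU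
  have hcy : ∀ c : ℝ, ContinuousAt (fun y ↦ c • (φ y - φ (γ t))) (γ t₀) := fun c ↦
    (hφc.sub continuousAt_const).const_smul c
  rw [slope_def_module] at hW'
  constructor
  · intro hlt
    have hmem : (t₀ - t)⁻¹ • (φ (γ t₀) - φ (γ t)) ∈ W := by
      rw [← neg_sub t t₀, ← neg_sub (φ (γ t)), inv_neg, neg_smul_neg]
      exact hW'
    filter_upwards [hsrc, hφc.eventually hU, (hcy _).eventually (hW.mem_nhds hmem)] with y hy hyU hyW
    have := hUW _ htU _ hyU _ (sub_pos.2 hlt) hyW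
    rwa [φ.left_inv hts, φ.left_inv hy] at this
  · intro hlt
    have hcy' : ContinuousAt (fun y ↦ (t - t₀)⁻¹ • (φ (γ t) - φ y)) (γ t₀) :=
      (continuousAt_const.sub hφc).const_smul (t - t₀)⁻¹
    filter_upwards [hsrc, hφc.eventually hU, hcy'.eventually (hW.mem_nhds hW')] with y hy hyU hyW
    have := hUW _ hyU _ htU _ (sub_pos.2 hlt) hyW
    rwa [φ.left_inv hts, φ.left_inv hy] at this

/-- The curve is followed to a point just before its end, from which every point near the end is
reached. -/
theorem isOpen_chronFuture (S : Spacetime n r M) (p : M) : IsOpen (S.chronFuture p) := by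
  refine isOpen_iff_mem_nhds.2 fun q hq ↦ ?_
  obtain ⟨γ, a, b, ⟨k, τ, hk, rfl, rfl, hτ⟩, rfl, rfl⟩ := hq
  obtain ⟨j, rfl⟩ := Nat.exists_eq_succ_of_ne_zero hk.ne'
  obtain ⟨hj, hC⟩ := hτ j (Nat.lt_succ_self j)
  have hmono : τ 0 ≤ τ j := by
    have : ∀ i ≤ j, τ 0 ≤ τ i := fun i hi ↦ by
      induction i with
      | zero => exact le_rfl
      | succ i ih => exact (ih (by omega)).trans (hτ i (by omega)).1.le
    exact this j le_rfl
  have hev := (hC.eventually_chron (right_mem_Icc.2 hj.le)).filter_mono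
    (nhdsWithin_mono _ (s := Ioo (τ j) (τ (j + 1))) (t := Icc (τ j) (τ (j + 1)) \ {τ (j + 1)})
      fun t ht ↦ ⟨Ioo_subset_Icc_self ht, ht.2.ne⟩)
  have : (𝓝[Ioo (τ j) (τ (j + 1))] (τ (j + 1))).NeBot := right_nhdsWithin_Ioo_neBot hj
  obtain ⟨t, ht, htm⟩ := (hev.and self_mem_nhdsWithin).exists
  filter_upwards [ht.1 htm.2] with y hy
  exact (chron_of_mem_Icc _ hτ le_rfl (hmono.trans_lt htm.1) htm.2.le).trans hy

theorem isOpen_chronPast (S : Spacetime n r M) (q : M) : IsOpen (S.chronPast q) := by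
  refine isOpen_iff_mem_nhds.2 fun p hp ↦ ?_
  obtain ⟨γ, a, b, ⟨k, τ, hk, rfl, rfl, hτ⟩, rfl, rfl⟩ := hp
  obtain ⟨h0, hC⟩ := hτ 0 hk
  have hmono : τ (0 + 1) ≤ τ k :=
    Nat.decreasingInduction' (P := fun j ↦ τ j ≤ τ k)
      (fun j hj _ ih ↦ ((hτ j hj).1.le).trans ih) hk le_rfl
  have hev := (hC.eventually_chron (left_mem_Icc.2 h0.le)).filter_mono
    (nhdsWithin_mono _ (s := Ioo (τ 0) (τ (0 + 1))) (t := Icc (τ 0) (τ (0 + 1)) \ {τ 0})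
      fun t ht ↦ ⟨Ioo_subset_Icc_self ht, ht.1.ne'⟩)
  have : (𝓝[Ioo (τ 0) (τ (0 + 1))] (τ 0)).NeBot := left_nhdsWithin_Ioo_neBot h0
  obtain ⟨t, ht, htm⟩ := (hev.and self_mem_nhdsWithin).exists
  filter_upwards [ht.2 htm.1] with y hy
  exact hy.trans (chron_of_mem_Icc _ hτ htm.1.le (htm.2.trans_le hmono) le_rfl)

end Spacetime

/-! ### The theorem -/

theorem mainTheorem4 (n : ℕ) (hn : 2 ≤ n) (r : ℕ∞) (hr : 3 ≤ r)
    (M : Type*) [TopologicalSpace M] [T2Space M] [ParacompactSpace M] [ConnectedSpace M]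
    [ChartedSpace (EuclideanSpace ℝ (Fin n)) M]
    [IsManifold (𝓡 n) 1 M] [IsManifold (𝓡 n) ((r : ℕ∞) : ℕ∞ω) M]
    (S : Spacetime n r M) (hchron : S.IsChronological)
    (hrefl : S.IsFutureReflective ∨ S.IsPastReflective) :
    ∃ t : M → ℝ, S.IsSemiTimeFunction t := by
  have : LocallyCompactSpace M := ChartedSpace.locallyCompactSpace (EuclideanSpace ℝ (Fin n)) M
  have : SigmaCompactSpace M := sigmaCompactSpace_of_connected_paracompact M
  have : SecondCountableTopology M :=
    ChartedSpace.secondCountable_of_sigmaCompact (EuclideanSpace ℝ (Fin n)) M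
  rcases hrefl with h | h
  -- For the reversed relation, with curves run backwards, future reflectivity is the required
  -- hypothesis. The function obtained decreases along ≪ and is negated.
  · obtain ⟨t, htc, ht⟩ := exists_continuous_strictMono_of_reflective
      (R := fun p q ↦ S.Chron q p) (fun hxy hyz ↦ hyz.trans hxy) hchron
      S.isOpen_chronPast S.isOpen_chronFuture
      (fun p q hpq ↦ by
        obtain ⟨σ, h0, h1, hσ⟩ := Spacetime.Chron.exists_param hpq
        refine ⟨fun s ↦ σ (1 - s), by simpa using h1, by simpa using h0, fun s hs t ht hst ↦
          hσ _ ⟨?_, ?_⟩ _ ⟨?_, ?_⟩ ?_⟩ <;> linarith [hs.1, hs.2, ht.1, ht.2])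
      (fun p q hq ↦ h q p hq)
    exact ⟨fun x ↦ -t x, htc.neg, fun p q hpq ↦ neg_lt_neg (ht q p hpq)⟩
  · exact exists_continuous_strictMono_of_reflective (R := S.Chron) (fun hxy hyz ↦ hxy.trans hyz)
      hchron S.isOpen_chronFuture S.isOpen_chronPast (fun p q hpq ↦ hpq.exists_param) h
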